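/- Let $G=\langle A,B\rangle$ be the free group on two generators $A,B$. Two elements $W,V\in G$ are called primitive associates if together they generate $G$, and $W$ is called primitive if it has a primitive associate. For every $p/q\in\mathbb Q\cup\{1/0\}$, written in lowest terms with $p,q\in\mathbb Z$, define an element $W_{p/q}\in G$ as follows. Put $W_{0/1}=B$ and $W_{1/0}=A$. If $m/n<r/s$ are non-negative fractions (with $1/0$ allowed) and $rn-ms=1$, put $W_{(m+r)/(n+s)}=W_{r/s}\,W_{m/n}$; this defines $W_{p/q}$ for all $p/q\ge 0$ and for $1/0$. If $p/q<0$, then $W_{p/q}$ is obtained from $W_{-p/q}$ by replacing $B$ by $B^{-1}$. Let $[x]$ denote the greatest integer $\le x$. (1) If $W\in G$ is primitive, then there are $\epsilon\in\{1,-1\}$ and relatively prime integers $p,q$ (which may be negative except as stated below) such that, up to conjugation (cyclic reduction) and inversion, $W$ equals $W_{\epsilon p/q}$, and such that at least one of the following holds. (a) $p\ge 1$, and either $p\le |q|$ or $q=0$. Up to conjugation and inversion, $W$ equals $$B^{n_0}A^{\epsilon}B^{n_1}A^{\epsilon}B^{n_2}\cdots A^{\epsilon}B^{n_p}$$ with integers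 $n_0=0$ and $n_1,\dots,n_p$ such that $\sum_{i=1}^p n_i=q$, each $n_j$ $(1\le j\le p)$ is $[q/p]$ or $[q/p]+1$, and no two adjacent exponents among $n_1,\dots,n_p$, taken in cyclic order, are both equal to $[q/p]+1$. (b) $q\ge 1$, and either $q\le |p|$ or $p=0$. Up to conjugation and inversion, $W$ equals $$A^{n_0}B^{\epsilon}A^{n_1}B^{\epsilon}A^{n_2}\cdots B^{\epsilon}A^{n_q}$$ with integers $n_0=0$ and $n_1,\dots,n_q$ such that $\sum_{i=1}^q n_i=p$, each $n_j$ $(1\le j\le q)$ is $[p/q]$ or $[p/q]+1$, and no two adjacent exponents among $n_1,\dots,n_q$, taken in cyclic order, are both equal to $[p/q]+1$. (2) For any two pairs $(p,q)$ and $(r,s)$ of relatively prime integers, $W_{p/q}$ and $W_{r/s}$ are primitive associates if and only if $|ps-qr|=1$. -/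

import Mathlib

namespace PrimitiveWords

/-- The free group `G = ⟨A, B⟩` of rank two. -/
abbrev F2 : Type := FreeGroup (Fin 2)

/-- The free generator `A`. -/
def A : F2 := FreeGroup.of 0

/-- The free generator `B`. -/
def B : F2 := FreeGroup.of 1

/-- `W` and `V` are a pair of primitive associates: together they generate `G`. -/
def PrimitiveAssociates (W V : F2) : Prop :=
  Subgroup.closure {W, V} = ⊤

/-- `W` is primitive: it has a primitive associate. -/
def IsPrimitive (W : F2) : Prop :=
  ∃ V : F2, PrimitiveAssociates W V

/-- Equality up to cyclic reduction (that is, up to conjugation) and inversion. -/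
def EqUpToConjInv (W V : F2) : Prop :=
  IsConj W V ∨ IsConj W⁻¹ V

/-- The word `Y^(n 0) X^ε Y^(n 1) X^ε Y^(n 2) ⋯ X^ε Y^(n k)`. -/
def formWord (X Y : F2) (ε : ℤ) (k : ℕ) (n : ℕ → ℤ) : F2 :=
  Y ^ n 0 * ((List.range k).map fun i => X ^ ε * Y ^ n (i + 1)).prod

/-- The conditions on the exponents `n 1, …, n k` with sum `m`: each is `[m/k]` or `[m/k] + 1`,
and no two adjacent ones are both `[m/k] + 1`. Words are considered up to cyclic permutation, so
the boundary exponent `n 0` is normalized to be `0`, and `n k` is adjacent to `n 1`. -/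
structure ExponentCondition (k : ℕ) (m : ℤ) (n : ℕ → ℤ) : Prop where
  boundary : n 0 = 0
  sum_eq : ∑ i ∈ Finset.Icc 1 k, n i = m
  values : ∀ j ∈ Finset.Icc 1 k, n j = ⌊(m : ℚ) / k⌋ ∨ n j = ⌊(m : ℚ) / k⌋ + 1
  not_adjacent : ∀ j ∈ Finset.Icc 1 k,
    ¬ (n j = ⌊(m : ℚ) / k⌋ + 1 ∧ n (if j = k then 1 else j + 1) = ⌊(m : ℚ) / k⌋ + 1)

/-- The word at `p/q` in the Farey tree, when the word `X` is placed at `0/1` and the word `Y`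
at `1/0`. The word at the Farey sum of two neighbours `m/n < r/s` is the word at `r/s` times the
word at `m/n`, see `fareyWord_farey_sum`. The recursion descends the tree: the word at `1/1` is
`Y * X`; if `p/q < 1` one continues between `0/1` and `1/1`, which has coordinates
`p/(q - p)`, otherwise between `1/1` and `1/0`, which has coordinates `(p - q)/q`. -/
def fareyWord (X Y : F2) (p q : ℕ) : F2 :=
  if p = 0 then X
  else if q = 0 then Y
  else if p < q then fareyWord X (Y * X) p (q - p)
  else fareyWord (Y * X) Y (p - q) q
termination_by p + q

theorem fareyWord_zero_one (X Y : F2) : fareyWord X Y 0 1 = X := by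
  rw [fareyWord]; simp

theorem fareyWord_one_zero (X Y : F2) : fareyWord X Y 1 0 = Y := by
  rw [fareyWord]; simp

theorem fareyWord_of_le (X Y : F2) {p q : ℕ} (h : p ≤ q) :
    fareyWord X Y p q = fareyWord X (Y * X) p (q - p) := by
  rcases Nat.eq_zero_or_pos p with rfl | hp
  · rw [fareyWord, fareyWord]; simp
  · rcases h.lt_or_eq with h | rfl
    · rw [fareyWord, if_neg (by omega), if_neg (by omega), if_pos h]
    · rw [fareyWord, if_neg (by omega), if_neg (by omega), if_neg (by omega), Nat.sub_self,
        fareyWord, if_pos rfl, fareyWord, if_neg (by omega), if_pos rfl]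

theorem fareyWord_of_ge (X Y : F2) {p q : ℕ} (hp : 0 < p) (h : q ≤ p) :
    fareyWord X Y p q = fareyWord (Y * X) Y (p - q) q := by
  rcases Nat.eq_zero_or_pos q with rfl | hq
  · rw [Nat.sub_zero, fareyWord, if_neg (by omega), if_pos rfl, fareyWord, if_neg (by omega),
      if_pos rfl]
  · rw [fareyWord, if_neg (by omega), if_neg (by omega), if_neg (by omega)]

theorem fareyWord_farey_sum (X Y : F2) (m n r s : ℕ) (h : r * n = m * s + 1) :
    fareyWord X Y (m + r) (n + s) = fareyWord X Y r s * fareyWord X Y m n := by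
  have hr : 0 < r := by rcases Nat.eq_zero_or_pos r with rfl | hr <;> omega
  have hn : 0 < n := by rcases Nat.eq_zero_or_pos n with rfl | hn <;> omega
  by_cases hrs : r ≤ s
  · have hmn : m ≤ n := by
      by_contra hc
      nlinarith
    rw [fareyWord_of_le X Y hrs, fareyWord_of_le X Y hmn,
      fareyWord_of_le X Y (show m + r ≤ n + s by omega),
      show n + s - (m + r) = (n - m) + (s - r) by omega]
    apply fareyWord_farey_sum
    zify [hmn, hrs]
    zify at h
    linarith
  · by_cases hnm : n ≤ m
    · rw [fareyWord_of_ge X Y hr (by omega : s ≤ r), fareyWord_of_ge X Y (by omega) hnm,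
        fareyWord_of_ge X Y (by omega) (show n + s ≤ m + r by omega),
        show m + r - (n + s) = (m - n) + (r - s) by omega]
      apply fareyWord_farey_sum
      have hsr : s ≤ r := by omega
      zify [hnm, hsr]
      zify at h
      linarith
    · have h1 : s + m = 0 := by nlinarith
      have hs : s = 0 := by omega
      have hm : m = 0 := by omega
      subst hs hm
      have h2 : r = 1 ∧ n = 1 := by simpa using h
      obtain ⟨rfl, rfl⟩ := h2
      rw [fareyWord_zero_one, fareyWord_one_zero, fareyWord_of_le X Y (by omega),
        show 0 + 1 = 1 from rfl, show 1 + 0 - 1 = 0 from rfl, fareyWord_one_zero]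
termination_by m + n + r + s

/-- The primitive word `W_{p/q}` attached to the rational `p/q` (in lowest terms, `1/0` allowed).
It has `|p|` letters `A^{±1}` and `|q|` letters `B^{±1}`: the words `W_{0/1} = B`, `W_{1/0} = A`
are extended along the Farey tree to all `p/q ≥ 0`, and for `p/q < 0` one replaces `B` by its
inverse. It depends only on the ratio of `p` and `q`. -/
def primitiveWord (p q : ℤ) : F2 :=
  fareyWord (if p * q < 0 then B⁻¹ else B) A p.natAbs q.natAbs

end PrimitiveWords

/-! Generating pairs are controlled by Nielsen's method. If a pair cannot be shortened by Nielsen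
moves and simultaneous conjugation, so little cancels that a reduced word of n letters in the pair
has length at least n. The words expressing A and B then have one letter, so the pair is (A, B) up
to order and inversion (`PrimitiveAssociates.nielsenGen`). Hence a `NielsenClosed` property that
holds for (A, B) holds for every generating pair.

Two such properties are used. The determinant in ℤ² is ±1, which gives necessity in (2). Being a
`FareyPair` is preserved because multiplying the words at two Farey neighbours, or dividing one by
the other, leads to their Farey sum or difference; so every primitive element is some Farey word up
to conjugation and inversion. Sufficiency in (2) is the Euclidean algorithm, each step being a
Nielsen move on the base pair (`NielsenClosed.fareyWord`).

For the normal form write q = kp + r with 0 ≤ r < p. The word is a product of syllables A B^k and A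
B^(k+1), one kind of which is isolated. If that is k+1, the exponents fit q. If it is k, negated
exponents fit -q, since [-q/p] + 1 = -k (`exists_balancedExponents`). This choice of sign accounts
for ε. Form (b) follows by exchanging the generators (`isConj_fareyWord_swap`). -/

namespace PrimitiveWords

/-! ### Common prefixes of lists -/

section CommonPrefix

/-- The length of the longest common prefix of two lists. -/
def commonPrefix {β : Type*} [DecidableEq β] : List β → List β → ℕ
  | a :: l, b :: m => if a = b then commonPrefix l m + 1 else 0
  | _, _ => 0

variable {β : Type*} [DecidableEq β]

theorem commonPrefix_comm : ∀ l m : List β, commonPrefix l m = commonPrefix m l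
  | [], [] => rfl
  | [], _ :: _ => rfl
  | _ :: _, [] => rfl
  | a :: l, b :: m => by simp only [commonPrefix, eq_comm (a := a), commonPrefix_comm l m]

/-- The ultrametric inequality; it expresses that the Cayley graph of a free group is a tree. -/
theorem min_commonPrefix_le :
    ∀ l m k : List β, min (commonPrefix l m) (commonPrefix m k) ≤ commonPrefix l k
  | [], _, _ => by simp [commonPrefix]
  | _ :: _, [], _ => by simp [commonPrefix]
  | _ :: _, _ :: _, [] => by simp [commonPrefix]
  | a :: l, b :: m, c :: k => by
    have := min_commonPrefix_le l m k
    by_cases h : a = b <;> by_cases h' : b = c <;> simp_all [commonPrefix]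

theorem take_commonPrefix :
    ∀ l m : List β, l.take (commonPrefix l m) = m.take (commonPrefix l m)
  | [], _ => by simp [commonPrefix]
  | _ :: _, [] => by simp [commonPrefix]
  | a :: l, b :: m => by
    by_cases h : a = b <;> simp [commonPrefix, h, take_commonPrefix l m]

end CommonPrefix

/-! ### Length and cancellation in free groups -/

section GromovProduct

open FreeGroup

theorem invRev_take_invRev {α : Type*} (l : List (α × Bool)) {k : ℕ} (hk : k ≤ l.length) :
    invRev ((invRev l).take k) = l.drop (l.length - k) := by
  conv_lhs => rw [← List.take_append_drop (l.length - k) l, invRev_append]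
  rw [List.take_left' (by rw [invRev_length, List.length_drop]; omega), invRev_invRev]

variable {α : Type*} [DecidableEq α]

theorem isReduced_invRev {l : List (α × Bool)} (h : IsReduced l) : IsReduced (invRev l) := by
  rw [isReduced_iff_reduce_eq] at h ⊢
  rw [reduce_invRev, h]

/-- The common prefix is exactly what cancels, once in each factor. -/
theorem length_reduce_invRev_append :
    ∀ l m : List (α × Bool), IsReduced l → IsReduced m →
      (reduce (invRev l ++ m)).length + 2 * commonPrefix l m = l.length + m.length
  | [], m, _, hm => by simp [commonPrefix, hm.reduce_eq]
  | a :: l, [], hl, _ => by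
    simp [commonPrefix, (isReduced_invRev hl).reduce_eq]
  | a :: l, b :: m, hl, hm => by
    by_cases h : a = b
    · subst h
      have ih := length_reduce_invRev_append l m (hl.infix ⟨[a], [], by simp⟩)
        (hm.infix ⟨[a], [], by simp⟩)
      have : reduce (invRev (a :: l) ++ a :: m) = reduce (invRev l ++ m) := by
        apply reduce.sound
        rw [← mul_mk, ← mul_mk, ← inv_mk, ← inv_mk]
        rw [show a :: l = [a] ++ l from rfl, show a :: m = [a] ++ m from rfl, ← mul_mk, ← mul_mk]
        group
      simp only [this, commonPrefix, if_true, List.length_cons]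
      omega
    · have : IsReduced (invRev (a :: l) ++ b :: m) := by
        refine List.isChain_append.2 ⟨isReduced_invRev hl, hm, ?_⟩
        rintro x hx y hy
        simp only [invRev, List.map_cons, List.reverse_cons, List.getLast?_append,
          List.getLast?_singleton, List.head?_cons, Option.mem_def, Option.some_or,
          Option.some.injEq] at hx hy
        subst hx hy
        intro h1
        by_contra h2
        exact h (Prod.ext h1 (by simpa using h2))
      simp [this.reduce_eq, commonPrefix, h]

/-- The length of the common initial segment of two elements of a free group. -/
def gromovProduct (x y : FreeGroup α) : ℕ := commonPrefix x.toWord y.toWord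

theorem norm_inv_mul_add (x y : FreeGroup α) :
    norm (x⁻¹ * y) + 2 * gromovProduct x y = norm x + norm y := by
  rw [FreeGroup.norm, toWord_mul, toWord_inv]
  exact length_reduce_invRev_append _ _ isReduced_toWord isReduced_toWord

theorem norm_mul_add (x y : FreeGroup α) :
    norm (x * y) + 2 * gromovProduct x⁻¹ y = norm x + norm y := by
  simpa using norm_inv_mul_add x⁻¹ y

theorem gromovProduct_comm (x y : FreeGroup α) : gromovProduct x y = gromovProduct y x :=
  commonPrefix_comm _ _

theorem min_gromovProduct_le (x y z : FreeGroup α) :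
    min (gromovProduct x y) (gromovProduct y z) ≤ gromovProduct x z :=
  min_commonPrefix_le _ _ _

/-- With x = c r c⁻¹ and r cyclically reduced and nonempty, c r r c⁻¹ is reduced as it stands, so
squaring adds the length of r. -/
theorem norm_lt_norm_mul_self {x : FreeGroup α} (hx : x ≠ 1) : norm x < norm (x * x) := by
  have h1 := reduceCyclically.reduce_flatten_replicate_succ (isReduced_toWord (x := x)) 1
  have h2 := reduceCyclically.conj_conjugator_reduceCyclically x.toWord
  have h3 : (x * x).toWord = _ := (toWord_mul x x).trans
    (Eq.trans (by simp [List.replicate]) h1)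
  have h4 : reduceCyclically x.toWord ≠ [] := by
    intro h
    rw [h] at h2
    apply hx
    rw [← mk_toWord (x := x), ← h2, List.append_nil, ← mul_mk, ← inv_mk, mul_inv_cancel]
  have h5 := List.length_pos_iff.2 h4
  have h2' := congrArg List.length h2
  rw [FreeGroup.norm, FreeGroup.norm, h3, ← h2']
  simp [List.replicate]
  omega

theorem two_mul_gromovProduct_inv_self_lt {x : FreeGroup α} (hx : x ≠ 1) :
    2 * gromovProduct x⁻¹ x < norm x := by
  have := norm_lt_norm_mul_self hx
  have := norm_mul_add x x
  omega

/-- If `t` and `y` begin alike and end alike, and these two common segments together make up all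
of `y`, then conjugating by the first half of `y` shortens the pair `(t * y⁻¹, y)`. -/
theorem exists_conj_shorter {t y : FreeGroup α} {k : ℕ} (hk : 0 < k)
    (h1 : gromovProduct t y = k) (h2 : gromovProduct t⁻¹ y⁻¹ = k) (hy : norm y = 2 * k)
    (ht : 2 * k ≤ norm t) :
    ∃ g : FreeGroup α, norm (g * y * g⁻¹) ≤ norm y ∧ norm (g * (t * y⁻¹) * g⁻¹) < norm t := by
  have e1 := take_commonPrefix t.toWord y.toWord
  have e2 := take_commonPrefix t⁻¹.toWord y⁻¹.toWord
  rw [gromovProduct] at h1 h2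
  rw [h1] at e1
  rw [h2] at e2
  set a := y.toWord.take k
  set b := y⁻¹.toWord.take k
  have ly : y.toWord.length = 2 * k := hy
  have lt : 2 * k ≤ t.toWord.length := ht
  -- Cut off the first and the last k letters, the latter read as the inverse of a prefix of z⁻¹.
  -- This gives t = a u b⁻¹ and y = a b⁻¹, so conjugation by a⁻¹ turns t y⁻¹ into u.
  have split : ∀ z : FreeGroup α, 2 * k ≤ z.toWord.length → ∃ u : List (α × Bool),
      z.toWord = z.toWord.take k ++ (u ++ invRev (z⁻¹.toWord.take k)) := by
    intro z hz
    refine ⟨(z.toWord.drop k).take (z.toWord.length - 2 * k), ?_⟩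
    have : invRev (z⁻¹.toWord.take k) = (z.toWord.drop k).drop (z.toWord.length - 2 * k) := by
      rw [List.drop_drop, toWord_inv, invRev_take_invRev _ (by omega)]
      congr 1
      omega
    rw [this, List.take_append_drop, List.take_append_drop]
  obtain ⟨u, hu⟩ := split t lt
  obtain ⟨v, hv⟩ := split y ly.ge
  rw [e1, e2] at hu
  have la : a.length = k := by simp [a, ly]; omega
  have lb : b.length = k := by simp [b, toWord_inv, ly]; omega
  have hv0 : v = [] := by
    have := congrArg List.length hv
    change _ = (a ++ (v ++ invRev b)).length at this
    rw [List.length_append, List.length_append, invRev_length] at this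
    exact List.length_eq_zero_iff.1 (by omega)
  have ey : y = mk a * (mk b)⁻¹ := by
    rw [← mk_toWord (x := y), hv, hv0, inv_mk, mul_mk, List.nil_append]
  have et : t = mk a * mk u * (mk b)⁻¹ := by
    rw [← mk_toWord (x := t), hu, inv_mk, mul_mk, mul_mk, List.append_assoc]
  have lu : t.toWord.length = 2 * k + u.length := by
    rw [hu]
    simp [la, lb, invRev_length]
    omega
  refine ⟨(mk a)⁻¹, ?_, ?_⟩
  · have : (mk a)⁻¹ * y * (mk a)⁻¹⁻¹ = (mk b)⁻¹ * mk a := by rw [ey]; group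
    rw [this]
    have n1 := norm_mul_le (mk b)⁻¹ (mk a)
    have n2 := norm_mk_le (L₁ := a)
    have n3 := norm_mk_le (L₁ := b)
    rw [norm_inv_eq] at n1
    omega
  · have : (mk a)⁻¹ * (t * y⁻¹) * (mk a)⁻¹⁻¹ = mk u := by rw [ey, et]; group
    rw [this]
    have n2 := norm_mk_le (L₁ := u)
    change _ < t.toWord.length
    omega

end GromovProduct

/-! ### Words in a Nielsen reduced system -/

section NielsenReduced

variable {α β : Type*}

open FreeGroup

/-- The value of a letter `x ^ ±1` of the alphabet `β` under the assignment `f`. -/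
def letterValue (f : β → FreeGroup α) (x : β × Bool) : FreeGroup α :=
  cond x.2 (f x.1) (f x.1)⁻¹

theorem letterValue_not (f : β → FreeGroup α) (i : β) (b : Bool) :
    letterValue f (i, !b) = (letterValue f (i, b))⁻¹ := by
  cases b <;> simp [letterValue]

variable [DecidableEq α]

/-- In a Nielsen reduced system no letter is absorbed by its two neighbours in a reduced word;
hence a reduced word is at least as long as its number of letters. -/
theorem length_le_norm_prod_aux {f : β → FreeGroup α}
    (h : ∀ x y z : β × Bool, (x.1 = y.1 → x.2 = y.2) → (y.1 = z.1 → y.2 = z.2) →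
      gromovProduct (letterValue f x)⁻¹ (letterValue f y) +
        gromovProduct (letterValue f y)⁻¹ (letterValue f z) < norm (letterValue f y)) :
    ∀ (L : List (β × Bool)) (x : β × Bool), IsReduced (x :: L) →
      ∀ y : β × Bool, (y.1 = x.1 → y.2 = x.2) →
        gromovProduct (letterValue f y)⁻¹ ((x :: L).map (letterValue f)).prod =
          gromovProduct (letterValue f y)⁻¹ (letterValue f x) ∧
        (x :: L).length + gromovProduct (letterValue f y)⁻¹ (letterValue f x) ≤
          norm ((x :: L).map (letterValue f)).prod
  | [], x, _, y, hy => by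
    have := h y x x hy (fun _ => rfl)
    simp only [List.map_cons, List.map_nil, List.prod_cons, List.prod_nil, mul_one,
      List.length_cons, List.length_nil, true_and]
    omega
  | x' :: L, x, hr, y, hy => by
    obtain ⟨hc, hr'⟩ := isReduced_cons_cons.1 hr
    obtain ⟨h1, h2⟩ := length_le_norm_prod_aux h L x' hr' x hc
    rw [List.map_cons, List.prod_cons]
    -- By `h3`, more of `s x` survives in `s x * w` than `(s y)⁻¹` shares with `s x`; the
    -- ultrametric inequality then makes the first common segment depend on `s x` only.
    set w := ((x' :: L).map (letterValue f)).prod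
    set s := letterValue f
    have h3 := h y x x' hy hc
    have h4 := norm_mul_add (s x) w
    have h5 := norm_inv_mul_add (s x) (s x * w)
    rw [inv_mul_cancel_left] at h5
    have h6 := min_gromovProduct_le (s y)⁻¹ (s x) (s x * w)
    have h7 := min_gromovProduct_le (s y)⁻¹ (s x * w) (s x)
    rw [gromovProduct_comm (s x * w)] at h7
    simp only [List.length_cons] at h2 ⊢
    omega

theorem length_le_norm_prod {f : β → FreeGroup α}
    (h : ∀ x y z : β × Bool, (x.1 = y.1 → x.2 = y.2) → (y.1 = z.1 → y.2 = z.2) →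
      gromovProduct (letterValue f x)⁻¹ (letterValue f y) +
        gromovProduct (letterValue f y)⁻¹ (letterValue f z) < norm (letterValue f y))
    (L : List (β × Bool)) (hL : IsReduced L) :
    L.length ≤ norm (L.map (letterValue f)).prod := by
  cases L with
  | nil => simp
  | cons x L =>
    have := (length_le_norm_prod_aux h L x hL x (fun _ => rfl)).2
    omega

end NielsenReduced

/-! ### Nielsen equivalence of generating pairs -/

section Nielsen

/-- A property of pairs that is invariant under Nielsen moves and simultaneous conjugation. -/
structure NielsenClosed (P : F2 → F2 → Prop) : Prop where
  swap : ∀ {W V}, P W V → P V W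
  inv : ∀ {W V}, P W V → P W⁻¹ V
  mul : ∀ {W V}, P W V → P (W * V) V
  conj : ∀ {W V} (g : F2), P W V → P (g * W * g⁻¹) (g * V * g⁻¹)

/-- The pairs that arise from `(A, B)` by Nielsen moves and simultaneous conjugation. -/
inductive NielsenGen : F2 → F2 → Prop
  | base : NielsenGen A B
  | swap {W V : F2} : NielsenGen W V → NielsenGen V W
  | inv {W V : F2} : NielsenGen W V → NielsenGen W⁻¹ V
  | mul {W V : F2} : NielsenGen W V → NielsenGen (W * V) V
  | conj {W V : F2} (g : F2) : NielsenGen W V → NielsenGen (g * W * g⁻¹) (g * V * g⁻¹)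

theorem NielsenGen.nielsenClosed : NielsenClosed NielsenGen where
  swap := .swap
  inv := .inv
  mul := .mul
  conj := .conj

namespace NielsenClosed

variable {P : F2 → F2 → Prop} (hP : NielsenClosed P)
include hP

theorem inv_right {W V : F2} (h : P W V) : P W V⁻¹ := hP.swap (hP.inv (hP.swap h))

theorem mul_inv {W V : F2} (h : P W V) : P (W * V⁻¹) V := by
  simpa using hP.inv_right (hP.mul (hP.inv_right h))

theorem of_mul {W V : F2} (h : P (W * V) V) : P W V := by simpa using hP.mul_inv h

theorem of_conj {W V : F2} (g : F2) (h : P (g * W * g⁻¹) (g * V * g⁻¹)) : P W V := by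
  simpa [mul_assoc] using hP.conj g⁻¹ h

/-- Order and signs are irrelevant for a Nielsen closed property, so later arguments may choose them
freely. -/
theorem letterValue_iff (f : Fin 2 → F2) {x y : Fin 2 × Bool} (h : x.1 ≠ y.1) :
    P (letterValue f x) (letterValue f y) ↔ P (f 0) (f 1) := by
  have hinv : ∀ {W V : F2}, P W⁻¹ V ↔ P W V :=
    fun {W V} => ⟨fun h => by simpa using hP.inv h, hP.inv⟩
  have hinv' : ∀ {W V : F2}, P W V⁻¹ ↔ P W V :=
    fun {W V} => ⟨fun h => by simpa using hP.inv_right h, hP.inv_right⟩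
  have hswap : P (f 1) (f 0) ↔ P (f 0) (f 1) := ⟨hP.swap, hP.swap⟩
  obtain ⟨i, b⟩ := x
  obtain ⟨j, c⟩ := y
  fin_cases i <;> fin_cases j <;> cases b <;> cases c <;>
    simp [letterValue, hinv, hinv', hswap] at h ⊢

end NielsenClosed

theorem PrimitiveAssociates.nielsenClosed : NielsenClosed PrimitiveAssociates where
  swap h := by rwa [PrimitiveAssociates, Set.pair_comm]
  inv {W V} h := by
    rw [PrimitiveAssociates, eq_top_iff] at h ⊢
    refine h.trans ((Subgroup.closure_le _).2 ?_)
    rintro x (rfl | rfl)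
    · exact inv_mem_iff.1 (Subgroup.subset_closure (by simp))
    · exact Subgroup.subset_closure (by simp)
  mul {W V} h := by
    rw [PrimitiveAssociates, eq_top_iff] at h ⊢
    refine h.trans ((Subgroup.closure_le _).2 ?_)
    have h1 : V ∈ Subgroup.closure {W * V, V} := Subgroup.subset_closure (by simp)
    rintro x (rfl | rfl)
    · exact (Subgroup.mul_mem_cancel_right _ h1).1 (Subgroup.subset_closure (by simp))
    · exact h1
  conj {W V} g h := by
    have := congrArg (Subgroup.map (MulAut.conj g).toMonoidHom) h
    rw [MonoidHom.map_closure, Set.image_pair,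
      Subgroup.map_top_of_surjective _ (MulAut.conj g).surjective] at this
    simpa [PrimitiveAssociates] using this

theorem not_primitiveAssociates_one (V : F2) : ¬ PrimitiveAssociates 1 V := by
  intro h
  rw [PrimitiveAssociates, Subgroup.closure_insert_one] at h
  obtain ⟨m, hm⟩ := Subgroup.mem_closure_singleton.1 (h ▸ Subgroup.mem_top A)
  obtain ⟨n, hn⟩ := Subgroup.mem_closure_singleton.1 (h ▸ Subgroup.mem_top B)
  have : A * B = B * A := by rw [← hm, ← hn, ← zpow_add, ← zpow_add, add_comm]
  exact absurd this (by decide)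

/-- Generating pairs are Nielsen equivalent to the standard basis. -/
theorem PrimitiveAssociates.nielsenGen : ∀ {W V : F2}, PrimitiveAssociates W V → NielsenGen W V := by
  suffices H : ∀ (n : ℕ) (f : Fin 2 → F2), (f 0).norm + (f 1).norm = n →
      PrimitiveAssociates (f 0) (f 1) → NielsenGen (f 0) (f 1) from
    fun {W V} h => H _ ![W, V] rfl h
  intro n
  induction n using Nat.strong_induction_on with
  | _ n ih =>
  intro f hn hf
  by_contra hcon
  have hPA := PrimitiveAssociates.nielsenClosed
  have hNG := NielsenGen.nielsenClosed
  have hfi : ∀ i, f i ≠ 1 := by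
    intro i hi
    fin_cases i <;> simp only [Fin.zero_eta, Fin.mk_one] at hi
    · exact not_primitiveAssociates_one _ (hi ▸ hf)
    · exact not_primitiveAssociates_one _ (hi ▸ hPA.swap hf)
  set s := letterValue f with hs
  have hs1 : ∀ x, s x ≠ 1 := by
    rintro ⟨i, b⟩
    cases b <;> simp [hs, letterValue, hfi]
  have hnorm : ∀ x y : Fin 2 × Bool, x.1 ≠ y.1 → (s x).norm + (s y).norm = n := by
    rintro ⟨i, b⟩ ⟨j, c⟩ h
    rw [← hn]
    fin_cases i <;> fin_cases j <;> cases b <;> cases c <;>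
      simp [hs, letterValue, FreeGroup.norm_inv_eq, add_comm] at h ⊢
  have ih' : ∀ W' V' : F2, W'.norm + V'.norm < n → PrimitiveAssociates W' V' → NielsenGen W' V' :=
    fun W' V' h hPA' => ih _ h ![W', V'] rfl hPA'
  -- A counterexample of minimal total length admits no shortening Nielsen move; hence at most half
  -- of either factor cancels (`hN1`).
  have hmin : ∀ x y : Fin 2 × Bool, x.1 ≠ y.1 → (s x).norm ≤ (s x * s y).norm := by
    intro x y hxy
    by_contra! hlt
    have := ih' (s x * s y) (s y) (by have := hnorm x y hxy; omega)
      (hPA.mul ((hPA.letterValue_iff f hxy).2 hf))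
    exact hcon ((hNG.letterValue_iff f hxy).1 (hNG.of_mul this))
  have hinv : ∀ x : Fin 2 × Bool, s (x.1, !x.2) = (s x)⁻¹ := fun x => letterValue_not f x.1 x.2
  have hmin' : ∀ x y : Fin 2 × Bool, x.1 ≠ y.1 → (s y).norm ≤ (s x * s y).norm := by
    intro x y hxy
    have := hmin (y.1, !y.2) (x.1, !x.2) hxy.symm
    rwa [hinv, hinv, ← mul_inv_rev, FreeGroup.norm_inv_eq, FreeGroup.norm_inv_eq] at this
  have hN1 : ∀ x y : Fin 2 × Bool, x.1 ≠ y.1 →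
      2 * gromovProduct (s x)⁻¹ (s y) ≤ (s x).norm ∧
        2 * gromovProduct (s x)⁻¹ (s y) ≤ (s y).norm := by
    intro x y hxy
    have h1 := hmin x y hxy
    have h2 := hmin' x y hxy
    have h3 := norm_mul_add (s x) (s y)
    omega
  have hN2 : ∀ x y z : Fin 2 × Bool, (x.1 = y.1 → x.2 = y.2) → (y.1 = z.1 → y.2 = z.2) →
      gromovProduct (s x)⁻¹ (s y) + gromovProduct (s y)⁻¹ (s z) < (s y).norm := by
    intro x y z hxy hyz
    have hself := two_mul_gromovProduct_inv_self_lt (hs1 y)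
    by_cases h1 : x.1 = y.1
    · have : x = y := Prod.ext h1 (hxy h1)
      subst this
      by_cases h2 : x.1 = z.1
      · have : x = z := Prod.ext h2 (hyz h2)
        subst this
        omega
      · have := (hN1 x z h2).1
        omega
    · have h1' := (hN1 x y h1).2
      by_cases h2 : y.1 = z.1
      · have : y = z := Prod.ext h2 (hyz h2)
        subst this
        omega
      · have h2' := (hN1 y z h2).1
        -- Failure means that exactly half of `s y` cancels on each side. As there are only two
        -- generators, x and z then have the same index.
        by_contra! hge
        have hxz : x.1 = z.1 := by omega
        have hk1 : 2 * gromovProduct (s x)⁻¹ (s y) = (s y).norm := by omega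
        have hk2 : 2 * gromovProduct (s y)⁻¹ (s z) = (s y).norm := by omega
        by_cases hb : x.2 = z.2
        · have : x = z := Prod.ext hxz hb
          subst this
          have hpos : 0 < (s y).norm :=
            Nat.pos_of_ne_zero fun h => hs1 y (FreeGroup.norm_eq_zero.1 h)
          -- No Nielsen move alone need shorten the pair here, but one followed by conjugation by
          -- `g` does. This is why conjugation is among the allowed moves.
          obtain ⟨g, hg1, hg2⟩ := exists_conj_shorter (t := (s x)⁻¹) (y := s y)
            (k := gromovProduct (s x)⁻¹ (s y)) (by omega) rfl
            (by rw [inv_inv, gromovProduct_comm]; omega) hk1.symm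
            (by rw [FreeGroup.norm_inv_eq]; exact (hN1 x y h1).1)
          rw [FreeGroup.norm_inv_eq] at hg2
          have hx' : (x.1, !x.2).1 ≠ y.1 := h1
          have hxy' : PrimitiveAssociates (s x)⁻¹ (s y) := by
            rw [← hinv]
            exact (hPA.letterValue_iff f hx').2 hf
          have := ih' (g * ((s x)⁻¹ * (s y)⁻¹) * g⁻¹) (g * s y * g⁻¹)
            (by have := hnorm x y h1; omega) (hPA.conj g (hPA.mul_inv hxy'))
          have hfin := hNG.mul (hNG.of_conj g this)
          rw [inv_mul_cancel_right, ← hinv] at hfin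
          exact hcon ((hNG.letterValue_iff f hx').1 hfin)
        · have hz : s z = (s x)⁻¹ := by
            rw [← hinv]
            congr 1
            exact Prod.ext hxz.symm (Bool.eq_not.2 (Ne.symm hb))
          -- Now `s y` and its inverse both share half their length with `(s x)⁻¹`, hence with each
          -- other, contradicting `two_mul_gromovProduct_inv_self_lt`.
          rw [hz] at hk2
          have := min_gromovProduct_le (s y)⁻¹ (s x)⁻¹ (s y)
          omega
  have hgen : ∀ i : Fin 2, ∃ x, s x = FreeGroup.of i := by
    intro i
    have hrange : (FreeGroup.lift f).range = ⊤ := by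
      rw [eq_top_iff, ← hf, Subgroup.closure_le]
      rintro w (rfl | rfl)
      · exact ⟨FreeGroup.of 0, by simp⟩
      · exact ⟨FreeGroup.of 1, by simp⟩
    obtain ⟨g, hg⟩ := MonoidHom.mem_range.1 (hrange ▸ Subgroup.mem_top (FreeGroup.of i))
    rw [← FreeGroup.mk_toWord (x := g), FreeGroup.lift_mk] at hg
    -- A generator has length one, so its expression in the pair is a single letter.
    have hlen := length_le_norm_prod hN2 g.toWord FreeGroup.isReduced_toWord
    change (g.toWord.map s).prod = _ at hg
    change _ ≤ ((g.toWord.map s).prod).norm at hlen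
    rw [hg, FreeGroup.norm_of] at hlen
    match h : g.toWord with
    | [] =>
      rw [h] at hg
      exact absurd hg (FreeGroup.one_ne_of i)
    | [x] =>
      rw [h] at hg
      exact ⟨x, by simpa using hg⟩
    | _ :: _ :: _ => simp [h] at hlen
  obtain ⟨x, hx⟩ := hgen 0
  obtain ⟨y, hy⟩ := hgen 1
  have hxy : x.1 ≠ y.1 := by
    intro h
    by_cases hb : x.2 = y.2
    · rw [Prod.ext h hb, hy] at hx
      exact absurd hx (by decide)
    · have : x = (y.1, !y.2) := Prod.ext h (Bool.eq_not.2 hb)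
      rw [this, hinv, hy] at hx
      exact absurd hx (by decide)
  refine hcon ((hNG.letterValue_iff f hxy).1 ?_)
  rw [← hs, hx, hy]
  exact .base

end Nielsen

/-! ### Farey neighbours and generating pairs -/

section FareyPairs

/-- Neighbours lie in the same half of the Farey tree unless they are 1/0 and 0/1. Descending into a
half replaces the base pair (Y, X) by (YX, X) or (Y, YX), a Nielsen move up to conjugation. -/
theorem NielsenClosed.fareyWord {P : F2 → F2 → Prop} (hP : NielsenClosed P) {X Y : F2}
    (hYX : P Y X) {p q r s : ℕ} (h : p * s = q * r + 1) :
    P (fareyWord X Y p q) (fareyWord X Y r s) := by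
  have hp : 0 < p := by rcases Nat.eq_zero_or_pos p with rfl | hr <;> omega
  have hs : 0 < s := by rcases Nat.eq_zero_or_pos s with rfl | hn <;> omega
  by_cases hpq : p ≤ q
  · have hrs : r ≤ s := by
      by_contra hc
      nlinarith
    rw [fareyWord_of_le X Y hpq, fareyWord_of_le X Y hrs]
    refine hP.fareyWord (hP.mul hYX) ?_
    zify [hpq, hrs]
    zify at h
    linarith
  · by_cases hsr : s ≤ r
    · have hqp : q ≤ p := by omega
      rw [fareyWord_of_ge X Y hp hqp, fareyWord_of_ge X Y (by omega) hsr]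
      refine hP.fareyWord (hP.swap ?_) ?_
      · simpa [mul_assoc] using hP.conj Y (hP.mul (hP.swap hYX))
      · zify [hsr, hqp]
        zify at h
        linarith
    · have h1 : q + r = 0 := by nlinarith
      obtain rfl : q = 0 := by omega
      obtain rfl : r = 0 := by omega
      obtain ⟨rfl, rfl⟩ : p = 1 ∧ s = 1 := by simpa using h
      rwa [fareyWord_zero_one, fareyWord_one_zero]
termination_by p + q + r + s

theorem toAdd_map_fareyWord (φ : F2 →* Multiplicative ℤ) (X Y : F2) {p q : ℕ}
    (h : p.Coprime q) :
    (φ (fareyWord X Y p q)).toAdd = p * (φ Y).toAdd + q * (φ X).toAdd := by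
  rcases Nat.eq_zero_or_pos p with rfl | hp
  · obtain rfl : q = 1 := by simpa using h
    simp [fareyWord_zero_one]
  rcases Nat.eq_zero_or_pos q with rfl | hq
  · obtain rfl : p = 1 := by simpa using h
    simp [fareyWord_one_zero]
  by_cases hpq : p ≤ q
  · rw [fareyWord_of_le X Y hpq,
      toAdd_map_fareyWord φ X (Y * X) ((Nat.coprime_sub_self_right hpq).2 h)]
    push_cast [hpq]
    simp only [map_mul, toAdd_mul]
    ring
  · have hqp : q ≤ p := by omega
    rw [fareyWord_of_ge X Y hp hqp,
      toAdd_map_fareyWord φ (Y * X) Y ((Nat.coprime_sub_self_left hqp).2 h)]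
    push_cast [hqp]
    simp only [map_mul, toAdd_mul]
    ring
termination_by p + q

/-- The exponent sum of the generator `i`. -/
def exponentSum (i : Fin 2) : F2 →* Multiplicative ℤ :=
  FreeGroup.lift fun j => Multiplicative.ofAdd (if j = i then 1 else 0)

/-- The determinant of the images of two elements in the abelianization `ℤ²`. -/
def abelianDet (W V : F2) : ℤ :=
  (exponentSum 0 W).toAdd * (exponentSum 1 V).toAdd -
    (exponentSum 1 W).toAdd * (exponentSum 0 V).toAdd

theorem nielsenClosed_abs_abelianDet : NielsenClosed fun W V => |abelianDet W V| = 1 where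
  swap {W V} h := by
    rw [← h, ← abs_neg]
    congr 1
    simp only [abelianDet]
    ring
  inv {W V} h := by
    rw [← h, ← abs_neg]
    congr 1
    simp only [abelianDet, map_inv, toAdd_inv]
    ring
  mul {W V} h := by
    rw [← h]
    congr 1
    simp only [abelianDet, map_mul, toAdd_mul]
    ring
  conj {W V} g h := by
    rw [← h]
    congr 1
    simp [abelianDet]

theorem NielsenGen.rec_nielsenClosed {P : F2 → F2 → Prop} (hP : NielsenClosed P) (h : P A B)
    {W V : F2} (hWV : NielsenGen W V) : P W V := by
  induction hWV with
  | base => exact h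
  | swap _ ih => exact hP.swap ih
  | inv _ ih => exact hP.inv ih
  | mul _ ih => exact hP.mul ih
  | conj g _ ih => exact hP.conj g ih

theorem PrimitiveAssociates.abs_abelianDet {W V : F2} (h : PrimitiveAssociates W V) :
    |abelianDet W V| = 1 :=
  h.nielsenGen.rec_nielsenClosed nielsenClosed_abs_abelianDet
    (by simp [abelianDet, exponentSum, A, B])

theorem primitiveAssociates_A_B : PrimitiveAssociates A B := by
  have := FreeGroup.closure_range_of (Fin 2)
  rw [PrimitiveAssociates, ← this]
  congr 1
  ext x
  simp [A, B, eq_comm]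

/-- The pairs that are simultaneously conjugate, up to inversion of their members, to the words at
two Farey neighbours. -/
def FareyPair (W V : F2) : Prop :=
  ∃ X : F2, (X = B ∨ X = B⁻¹) ∧ ∃ p q r s : ℕ, (p * s = q * r + 1 ∨ q * r = p * s + 1) ∧
    ∃ g : F2,
      (W = g * fareyWord X A p q * g⁻¹ ∨ W = g * (fareyWord X A p q)⁻¹ * g⁻¹) ∧
      (V = g * fareyWord X A r s * g⁻¹ ∨ V = g * (fareyWord X A r s)⁻¹ * g⁻¹)

/-! ### Invariance of Farey pairs under Nielsen moves -/

namespace FareyPair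

theorem swap {W V : F2} : FareyPair W V → FareyPair V W := by
  rintro ⟨X, hX, p, q, r, s, h, g, h1, h2⟩
  refine ⟨X, hX, r, s, p, q, ?_, g, h2, h1⟩
  rw [mul_comm r, mul_comm s]
  exact h.symm

theorem inv {W V : F2} : FareyPair W V → FareyPair W⁻¹ V := by
  rintro ⟨X, hX, p, q, r, s, h, g, h1, h2⟩
  refine ⟨X, hX, p, q, r, s, h, g, ?_, h2⟩
  rcases h1 with rfl | rfl
  · right; group
  · left; group

theorem conj {W V : F2} (k : F2) : FareyPair W V → FareyPair (k * W * k⁻¹) (k * V * k⁻¹) := by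
  rintro ⟨X, hX, p, q, r, s, h, g, h1, h2⟩
  refine ⟨X, hX, p, q, r, s, h, k * g, ?_, ?_⟩
  · exact h1.imp (by rintro rfl; group) (by rintro rfl; group)
  · exact h2.imp (by rintro rfl; group) (by rintro rfl; group)

theorem fareyWord_mul {X : F2} (hX : X = B ∨ X = B⁻¹) {p q r s : ℕ}
    (h : p * s = q * r + 1 ∨ q * r = p * s + 1) :
    FareyPair (fareyWord X A p q * fareyWord X A r s) (fareyWord X A r s) := by
  rcases h with h | h
  · have e := fareyWord_farey_sum X A r s p q (by linarith)
    exact ⟨X, hX, r + p, s + q, r, s, .inl (by linarith), 1, .inl (by rw [e]; group),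
      .inl (by group)⟩
  · have e := fareyWord_farey_sum X A p q r s (by linarith)
    -- Here the word at the Farey sum is the product in the opposite order, a conjugate by the
    -- second word.
    exact ⟨X, hX, p + r, q + s, r, s, .inr (by linarith), (fareyWord X A r s)⁻¹,
      .inl (by rw [e]; group), .inl (by group)⟩

/-- Ensures that the Farey difference of two neighbours has nonnegative coordinates up to a common
sign, the only exception being the root pair 1/0, 0/1. -/
theorem le_or_eq_of_det {p q r s : ℕ} (h : p * s = q * r + 1) :
    (r ≤ p ∧ s ≤ q) ∨ (p ≤ r ∧ q ≤ s) ∨ (p = 1 ∧ q = 0 ∧ r = 0 ∧ s = 1) := by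
  have hp : 0 < p := by rcases Nat.eq_zero_or_pos p with rfl | hr <;> omega
  have hs : 0 < s := by rcases Nat.eq_zero_or_pos s with rfl | hn <;> omega
  rcases Nat.lt_or_ge r p with h1 | h1
  · rcases Nat.lt_or_ge q s with h2 | h2
    · obtain ⟨c, rfl⟩ := Nat.exists_eq_add_of_lt h1
      obtain ⟨d, rfl⟩ := Nat.exists_eq_add_of_lt h2
      right; right
      have : r + q + c + d = 0 := by nlinarith
      omega
    · exact .inl ⟨h1.le, h2⟩
  · rcases Nat.lt_or_ge s q with h2 | h2
    · nlinarith
    · exact .inr (.inl ⟨h1, h2⟩)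

/-- Dividing undoes a Farey sum. Only at the root pair does it leave the nonnegative fractions: A
X⁻¹ is the word at 1/1 for the base X⁻¹, so B and B⁻¹ change roles. -/
theorem fareyWord_mul_inv {X : F2} (hX : X = B ∨ X = B⁻¹) {p q r s : ℕ}
    (h : p * s = q * r + 1 ∨ q * r = p * s + 1) :
    FareyPair (fareyWord X A p q * (fareyWord X A r s)⁻¹) (fareyWord X A r s) := by
  have hX' : X⁻¹ = B ∨ X⁻¹ = B⁻¹ := by rcases hX with rfl | rfl <;> simp
  have e11 : fareyWord X⁻¹ A 1 1 = A * X⁻¹ := by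
    rw [fareyWord_of_le _ _ le_rfl, Nat.sub_self, fareyWord_one_zero]
  rcases h with h | h
  · rcases le_or_eq_of_det h with ⟨h1, h2⟩ | ⟨h1, h2⟩ | ⟨rfl, rfl, rfl, rfl⟩
    · obtain ⟨c, rfl⟩ := Nat.exists_eq_add_of_le h1
      obtain ⟨d, rfl⟩ := Nat.exists_eq_add_of_le h2
      have e := fareyWord_farey_sum X A r s c d (by linarith)
      exact ⟨X, hX, c, d, r, s, .inl (by linarith), 1, .inl (by rw [e]; group),
        .inl (by group)⟩
    · obtain ⟨c, rfl⟩ := Nat.exists_eq_add_of_le h1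
      obtain ⟨d, rfl⟩ := Nat.exists_eq_add_of_le h2
      have e := fareyWord_farey_sum X A c d p q (by linarith)
      rw [add_comm c, add_comm d] at e
      exact ⟨X, hX, c, d, p + c, q + d, .inr (by linarith), fareyWord X A (p + c) (q + d),
        .inr (by rw [e]; group), .inl (by group)⟩
    · exact ⟨X⁻¹, hX', 1, 1, 0, 1, .inl (by norm_num), 1,
        .inl (by rw [e11, fareyWord_zero_one, fareyWord_one_zero]; group),
        .inr (by rw [fareyWord_zero_one, fareyWord_zero_one]; group)⟩
  · rcases le_or_eq_of_det (p := r) (q := s) (r := p) (s := q) (by linarith) with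
      ⟨h1, h2⟩ | ⟨h1, h2⟩ | ⟨rfl, rfl, rfl, rfl⟩
    · obtain ⟨c, rfl⟩ := Nat.exists_eq_add_of_le h1
      obtain ⟨d, rfl⟩ := Nat.exists_eq_add_of_le h2
      have e := fareyWord_farey_sum X A p q c d (by linarith)
      exact ⟨X, hX, c, d, p + c, q + d, .inl (by linarith), 1,
        .inr (by rw [e]; group), .inl (by group)⟩
    · obtain ⟨c, rfl⟩ := Nat.exists_eq_add_of_le h1
      obtain ⟨d, rfl⟩ := Nat.exists_eq_add_of_le h2
      have e := fareyWord_farey_sum X A c d r s (by linarith)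
      rw [add_comm c, add_comm d] at e
      exact ⟨X, hX, c, d, r, s, .inr (by linarith), fareyWord X A r s,
        .inl (by rw [e]), .inl (by group)⟩
    · exact ⟨X⁻¹, hX', 1, 1, 1, 0, .inr (by norm_num), 1,
        .inr (by rw [e11, fareyWord_zero_one, fareyWord_one_zero]; group),
        .inl (by rw [fareyWord_one_zero, fareyWord_one_zero]; group)⟩

theorem mul {W V : F2} : FareyPair W V → FareyPair (W * V) V := by
  rintro ⟨X, hX, p, q, r, s, h, g, h1, h2⟩
  have H1 := fareyWord_mul hX h
  have H2 := fareyWord_mul_inv hX h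
  set x := fareyWord X A p q
  set y := fareyWord X A r s
  have K1 : FareyPair (x * y⁻¹) y⁻¹ := (inv (swap H2)).swap
  have K2 : FareyPair (x⁻¹ * y) y := by
    have := conj y⁻¹ (inv H2)
    rwa [show y⁻¹ * (x * y⁻¹)⁻¹ * y⁻¹⁻¹ = x⁻¹ * y by group,
      show y⁻¹ * y * y⁻¹⁻¹ = y by group] at this
  have K3 : FareyPair (x⁻¹ * y⁻¹) y⁻¹ := by
    have := conj y (inv H1)
    rw [show y * (x * y)⁻¹ * y⁻¹ = x⁻¹ * y⁻¹ by
      simp only [mul_inv_rev, mul_inv_cancel_left],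
      show y * y * y⁻¹ = y by group] at this
    exact (inv (swap this)).swap
  rcases h1 with rfl | rfl <;> rcases h2 with rfl | rfl
  · simpa [mul_assoc] using conj g H1
  · simpa [mul_assoc] using conj g K1
  · simpa [mul_assoc] using conj g K2
  · simpa [mul_assoc] using conj g K3

theorem nielsenClosed : NielsenClosed FareyPair where
  swap := swap
  inv := inv
  mul := mul
  conj := conj

end FareyPair

theorem PrimitiveAssociates.fareyPair {W V : F2} (h : PrimitiveAssociates W V) :
    FareyPair W V :=
  h.nielsenGen.rec_nielsenClosed FareyPair.nielsenClosed
    ⟨B, .inl rfl, 1, 0, 0, 1, .inl (by norm_num), 1,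
      .inl (by simp [fareyWord_one_zero]), .inl (by simp [fareyWord_zero_one])⟩

theorem eqUpToConjInv_of_conj {W U : F2} (g : F2)
    (h : W = g * U * g⁻¹ ∨ W = g * U⁻¹ * g⁻¹) : EqUpToConjInv W U := by
  rcases h with rfl | rfl
  · exact .inl (isConj_iff.2 ⟨g⁻¹, by group⟩)
  · exact .inr (isConj_iff.2 ⟨g⁻¹, by group⟩)

theorem IsPrimitive.exists_fareyWord {W : F2} (h : IsPrimitive W) :
    ∃ X : F2, (X = B ∨ X = B⁻¹) ∧ ∃ p q : ℕ, p.Coprime q ∧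
      EqUpToConjInv W (fareyWord X A p q) := by
  obtain ⟨V, hV⟩ := h
  obtain ⟨X, hX, p, q, r, s, h, g, h1, -⟩ := PrimitiveAssociates.fareyPair hV
  refine ⟨X, hX, p, q, ?_, eqUpToConjInv_of_conj g h1⟩
  rw [← Nat.isCoprime_iff_coprime]
  rcases h with h | h
  · exact ⟨s, -r, by zify at h; linarith⟩
  · exact ⟨-s, r, by zify at h; linarith⟩

/-! ### Signed fractions and the associate criterion -/

/-- At 0/1 and 1/0 the sign of B matters only up to inversion. This freedom lets two neighbours
share one base X. -/
theorem primitiveWord_eq {p q : ℤ} {X : F2} (hpq : IsCoprime p q)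
    (hX : X = B ∨ X = B⁻¹) (h : 0 < p * q → X = B) (h' : p * q < 0 → X = B⁻¹) :
    primitiveWord p q = fareyWord X A p.natAbs q.natAbs ∨
      primitiveWord p q = (fareyWord X A p.natAbs q.natAbs)⁻¹ := by
  rw [primitiveWord]
  rcases lt_trichotomy (p * q) 0 with h0 | h0 | h0
  · rw [if_pos h0, h' h0]
    exact .inl rfl
  · rw [if_neg (by omega)]
    rcases mul_eq_zero.1 h0 with rfl | rfl
    · have : q.natAbs = 1 := Int.isUnit_iff_natAbs_eq.1 (isCoprime_zero_left.1 hpq)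
      rw [this, Int.natAbs_zero, fareyWord_zero_one, fareyWord_zero_one]
      rcases hX with rfl | rfl <;> simp
    · have : p.natAbs = 1 := Int.isUnit_iff_natAbs_eq.1 (isCoprime_zero_right.1 hpq)
      rw [this, Int.natAbs_zero, fareyWord_one_zero, fareyWord_one_zero]
      exact .inl rfl
  · rw [if_neg (by omega), h h0]
    exact .inl rfl

theorem exponentSum_primitiveWord {p q : ℤ} (hpq : IsCoprime p q) :
    ∃ e : ℤ, |e| = 1 ∧ (exponentSum 0 (primitiveWord p q)).toAdd = e * p ∧
      (exponentSum 1 (primitiveWord p q)).toAdd = e * q := by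
  have hc : p.natAbs.Coprime q.natAbs := Int.isCoprime_iff_gcd_eq_one.1 hpq
  rw [primitiveWord, toAdd_map_fareyWord _ _ _ hc, toAdd_map_fareyWord _ _ _ hc]
  by_cases h : p * q < 0
  · rcases mul_neg_iff.1 h with ⟨h1, h2⟩ | ⟨h1, h2⟩
    · refine ⟨1, by simp, ?_, ?_⟩ <;>
        simp [h, exponentSum, A, B, abs_of_pos h1, abs_of_neg h2]
    · refine ⟨-1, by simp, ?_, ?_⟩ <;>
        simp [h, exponentSum, A, B, abs_of_neg h1, abs_of_pos h2]
  · rcases mul_nonneg_iff.1 (not_lt.1 h) with ⟨h1, h2⟩ | ⟨h1, h2⟩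
    · refine ⟨1, by simp, ?_, ?_⟩ <;>
        simp [h, exponentSum, A, B, abs_of_nonneg h1, abs_of_nonneg h2]
    · refine ⟨-1, by simp, ?_, ?_⟩ <;>
        simp [h, exponentSum, A, B, abs_of_nonpos h1, abs_of_nonpos h2]

theorem mul_mul_nonneg_of_abs_sub_eq_one {p q r s : ℤ} (h : |p * s - q * r| = 1) :
    0 ≤ (p * s) * (q * r) := by
  by_contra! hc
  rcases mul_neg_iff.1 hc with ⟨h1, h2⟩ | ⟨h1, h2⟩
  · rw [abs_of_pos (by omega)] at h; omega
  · rw [abs_of_neg (by omega)] at h; omega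

theorem primitiveAssociates_primitiveWord_iff {p q r s : ℤ} (hpq : IsCoprime p q)
    (hrs : IsCoprime r s) :
    PrimitiveAssociates (primitiveWord p q) (primitiveWord r s) ↔ |p * s - q * r| = 1 := by
  constructor
  · intro h
    have h1 := h.abs_abelianDet
    obtain ⟨e, he, h2, h3⟩ := exponentSum_primitiveWord hpq
    obtain ⟨e', he', h4, h5⟩ := exponentSum_primitiveWord hrs
    rw [abelianDet, h2, h3, h4, h5,
      show e * p * (e' * s) - e * q * (e' * r) = e * e' * (p * s - q * r) by ring,
      abs_mul, abs_mul, he, he', one_mul, one_mul] at h1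
    exact h1
  · intro h
    have hsign := mul_mul_nonneg_of_abs_sub_eq_one h
    have hP := PrimitiveAssociates.nielsenClosed
    obtain ⟨X, hX, hX1, hX2, hX3, hX4⟩ : ∃ X : F2, (X = B ∨ X = B⁻¹) ∧
        (0 < p * q → X = B) ∧ (p * q < 0 → X = B⁻¹) ∧
        (0 < r * s → X = B) ∧ (r * s < 0 → X = B⁻¹) := by
      -- Neighbouring fractions never have strictly opposite signs, so one X serves both.
      have key : 0 ≤ (p * q) * (r * s) := by linarith
      by_cases hneg : p * q < 0 ∨ r * s < 0
      · refine ⟨B⁻¹, .inr rfl, fun h0 => ?_, fun _ => rfl, fun h0 => ?_, fun _ => rfl⟩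
        · rcases hneg with h1 | h1 <;> nlinarith
        · rcases hneg with h1 | h1 <;> nlinarith
      · push Not at hneg
        exact ⟨B, .inl rfl, fun _ => rfl, fun h0 => by omega, fun _ => rfl, fun h0 => by omega⟩
    have hAX : PrimitiveAssociates A X := by
      rcases hX with rfl | rfl
      · exact primitiveAssociates_A_B
      · exact hP.inv_right primitiveAssociates_A_B
    have habs : |(|p| * |s| - |q| * |r| : ℤ)| = 1 := by
      rw [← abs_mul, ← abs_mul, ← h]
      rcases mul_nonneg_iff.1 hsign with ⟨h1, h2⟩ | ⟨h1, h2⟩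
      · rw [abs_of_nonneg h1, abs_of_nonneg h2]
      · rw [abs_of_nonpos h1, abs_of_nonpos h2, ← abs_neg]
        congr 1
        ring
    have hmain : PrimitiveAssociates (fareyWord X A p.natAbs q.natAbs)
        (fareyWord X A r.natAbs s.natAbs) := by
      rcases (abs_eq zero_le_one).1 habs with h1 | h1
      · exact hP.fareyWord hAX (by zify; linarith)
      · exact hP.swap (hP.fareyWord hAX (by zify; linarith))
    rcases primitiveWord_eq hpq hX hX1 hX2 with h1 | h1 <;>
      rcases primitiveWord_eq hrs hX hX3 hX4 with h2 | h2 <;> rw [h1, h2]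
    · exact hmain
    · exact hP.inv_right hmain
    · exact hP.inv hmain
    · exact hP.inv (hP.inv_right hmain)

end FareyPairs

/-! ### Exponent sequences of Farey words -/

section ExponentLists

/-- The positive word in `X` and `Y` that spells the Farey word, with `true` for `Y`. -/
theorem exists_boolWord (p q : ℕ) (h : p.Coprime q) :
    ∃ L : List Bool, L.count true = p ∧ L.count false = q ∧
      ∀ X Y : F2, fareyWord X Y p q = (L.map fun b => cond b Y X).prod := by
  rcases Nat.eq_zero_or_pos p with rfl | hp
  · obtain rfl : q = 1 := by simpa using h
    exact ⟨[false], by simp, by simp, fun X Y => by simp [fareyWord_zero_one]⟩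
  rcases Nat.eq_zero_or_pos q with rfl | hq
  · obtain rfl : p = 1 := by simpa using h
    exact ⟨[true], by simp, by simp, fun X Y => by simp [fareyWord_one_zero]⟩
  by_cases hpq : p ≤ q
  · obtain ⟨L, h1, h2, h3⟩ := exists_boolWord p (q - p) ((Nat.coprime_sub_self_right hpq).2 h)
    have key : ∀ K : List Bool,
        (K.flatMap fun b => cond b [true, false] [false]).count true = K.count true ∧
        (K.flatMap fun b => cond b [true, false] [false]).count false =
          K.count true + K.count false ∧
        ∀ X Y : F2, (K.map fun b => cond b (Y * X) X).prod =
          ((K.flatMap fun b => cond b [true, false] [false]).map fun b => cond b Y X).prod := by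
      intro K
      induction K with
      | nil => simp
      | cons b K ih =>
        obtain ⟨i1, i2, i3⟩ := ih
        cases b <;> simp [-List.count_true_add_count_false, -List.count_false_add_count_true,
          i1, i2, i3, mul_assoc] <;> omega
    obtain ⟨k1, k2, k3⟩ := key L
    exact ⟨_, k1.trans h1, by omega, fun X Y => by rw [fareyWord_of_le X Y hpq, h3, k3]⟩
  · have hqp : q ≤ p := by omega
    obtain ⟨L, h1, h2, h3⟩ := exists_boolWord (p - q) q ((Nat.coprime_sub_self_left hqp).2 h)
    have key : ∀ K : List Bool,
        (K.flatMap fun b => cond b [true] [true, false]).count true =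
          K.count true + K.count false ∧
        (K.flatMap fun b => cond b [true] [true, false]).count false = K.count false ∧
        ∀ X Y : F2, (K.map fun b => cond b Y (Y * X)).prod =
          ((K.flatMap fun b => cond b [true] [true, false]).map fun b => cond b Y X).prod := by
      intro K
      induction K with
      | nil => simp
      | cons b K ih =>
        obtain ⟨i1, i2, i3⟩ := ih
        cases b <;> simp [-List.count_true_add_count_false, -List.count_false_add_count_true,
          i1, i2, i3, mul_assoc] <;> omega
    obtain ⟨k1, k2, k3⟩ := key L
    exact ⟨_, by omega, k2.trans h2, fun X Y => by rw [fareyWord_of_ge X Y hp hqp, h3, k3]⟩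
termination_by p + q

theorem fareyWord_mul_add (X Y : F2) {p : ℕ} (r : ℕ) :
    ∀ k : ℕ, fareyWord X Y p (k * p + r) = fareyWord X (Y * X ^ k) p r
  | 0 => by simp
  | k + 1 => by
    rw [fareyWord_of_le X Y (by nlinarith), show (k + 1) * p + r - p = k * p + r by
      rw [add_mul, one_mul]; omega, fareyWord_mul_add X (Y * X) r k, mul_assoc, ← pow_succ']

/-- Cyclic exponent sequences of length `k` and sum `m` as in `ExponentCondition`. -/
structure BalancedExponents (k : ℕ) (m : ℤ) (E : List ℤ) : Prop where
  length_eq : E.length = k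
  sum_eq : E.sum = m
  values : ∀ x ∈ E, x = ⌊(m : ℚ) / k⌋ ∨ x = ⌊(m : ℚ) / k⌋ + 1
  -- Doubling the list turns cyclic adjacency into ordinary adjacency; a single entry is adjacent to
  -- itself.
  isolated : ¬ [⌊(m : ℚ) / k⌋ + 1, ⌊(m : ℚ) / k⌋ + 1] <:+: E ++ E

theorem BalancedExponents.reverse {k : ℕ} {m : ℤ} {E : List ℤ} (h : BalancedExponents k m E) :
    BalancedExponents k m E.reverse where
  length_eq := by rw [List.length_reverse, h.length_eq]
  sum_eq := by rw [List.sum_reverse, h.sum_eq]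
  values x hx := h.values x (List.mem_reverse.1 hx)
  isolated hinf := h.isolated (by
    rw [← List.reverse_append, ← List.reverse_infix, List.reverse_reverse] at hinf
    exact hinf)

theorem BalancedExponents.exponentCondition {k : ℕ} {m : ℤ} {E : List ℤ}
    (h : BalancedExponents k m E) : ExponentCondition k m fun i => (0 :: E).getD i 0 := by
  obtain ⟨rfl, hsum, hval, hiso⟩ := h
  refine ⟨rfl, ?_, ?_, ?_⟩
  · rw [← hsum, ← Finset.Ico_add_one_right_eq_Icc, Finset.sum_Ico_eq_sum_range,
      Nat.add_sub_cancel, Finset.sum_range, ← Fin.sum_univ_getElem]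
    refine Finset.sum_congr rfl fun i _ => ?_
    rw [add_comm 1, List.getD_cons_succ, List.getD_eq_getElem]
  · intro j hj
    obtain ⟨h1, h2⟩ := Finset.mem_Icc.1 hj
    obtain ⟨i, rfl⟩ := Nat.exists_eq_add_of_le' h1
    have hi : i < E.length := by omega
    simpa [hi] using hval E[i] (List.getElem_mem hi)
  · rintro j hj ⟨hc1, hc2⟩
    obtain ⟨h1, h2⟩ := Finset.mem_Icc.1 hj
    obtain ⟨i, rfl⟩ := Nat.exists_eq_add_of_le' h1
    have hi : i < E.length := by omega
    apply hiso
    rw [List.infix_iff_getElem?]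
    refine ⟨i, by simp; omega, fun t ht => ?_⟩
    have ht' : t = 0 ∨ t = 1 := by simp at ht; omega
    rcases ht' with rfl | rfl
    · rw [zero_add, List.getElem?_append_left hi]
      simpa [hi] using hc1
    · by_cases hlast : i + 1 = E.length
      · rw [if_pos hlast] at hc2
        rw [List.getElem?_append_right (by omega), show 1 + i - E.length = 0 by omega]
        have : 0 < E.length := by omega
        simpa [this] using hc2
      · have hi' : i + 1 < E.length := by omega
        rw [if_neg hlast] at hc2
        rw [add_comm, List.getElem?_append_left hi']
        simpa [hi'] using hc2

theorem formWord_getD (X Y : F2) (ε : ℤ) (E : List ℤ) :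
    formWord X Y ε E.length (fun i => (0 :: E).getD i 0) =
      (E.map fun m => X ^ ε * Y ^ m).prod := by
  rw [formWord]
  simp only [List.getD_cons_zero, zpow_zero, one_mul, List.getD_cons_succ]
  congr 1
  refine List.ext_getElem (by simp) fun i h1 h2 => ?_
  simp at h1
  simp [h1]

/-- In a concatenation of blocks u and uc, every c is preceded by u within its block. -/
theorem not_infix_flatMap_left {β : Type*} {u c : β} (h : c ≠ u) :
    ∀ K : List Bool, ¬ [c, c] <:+: K.flatMap fun b => cond b [u] [u, c]
  | [] => by simp
  | true :: K => by
    have := not_infix_flatMap_left h K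
    simp [List.infix_cons_iff, this, h]
  | false :: K => by
    have := not_infix_flatMap_left h K
    rcases K with _ | ⟨_ | _, K⟩ <;> simp_all [List.infix_cons_iff]

theorem not_infix_flatMap_right {β : Type*} {u c : β} (h : c ≠ u) :
    ∀ K : List Bool, ¬ [c, c] <:+: K.flatMap fun b => cond b [c, u] [u]
  | [] => by simp
  | true :: K => by
    have := not_infix_flatMap_right h K
    simp [List.infix_cons_iff, this, h]
  | false :: K => by
    have := not_infix_flatMap_right h K
    simp [List.infix_cons_iff, this, h]

/-- After k + 1 Euclidean steps the base words are Y X^k, occurring p - r times, and Y X^(k+1),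
occurring r times. One more step absorbs each occurrence of the rarer one into a block with the
other, which isolates it. -/
theorem exists_balancedExponents {p q : ℕ} (hp : 0 < p) (h : p.Coprime q) :
    ∃ E : List ℤ, (∀ X Y : F2, fareyWord X Y p q = (E.map fun m => Y * X ^ m).prod) ∧
      (BalancedExponents p q E ∨ BalancedExponents p (-q) (E.map Neg.neg)) := by
  obtain ⟨k, r, hr, rfl⟩ : ∃ k r, r < p ∧ q = k * p + r :=
    ⟨q / p, q % p, Nat.mod_lt _ hp, (Nat.div_add_mod' q p).symm⟩
  have hc : p.Coprime r := by simpa using h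
  have hc' : (p - r).Coprime r := (Nat.coprime_sub_self_left hr.le).2 hc
  have hpQ : (0 : ℚ) < p := by exact_mod_cast hp
  have hrQ : (r : ℚ) < p := by exact_mod_cast hr
  by_cases hle : r ≤ p - r
  · obtain ⟨L, h1, h2, h3⟩ := exists_boolWord (p - r - r) r ((Nat.coprime_sub_self_left hle).2 hc')
    have hfloor : ⌊(((k * p + r : ℕ) : ℤ) : ℚ) / p⌋ = k := by
      rw [Int.floor_eq_iff, le_div_iff₀ hpQ, div_lt_iff₀ hpQ]
      push_cast
      constructor <;> nlinarith [(Nat.cast_nonneg r : (0 : ℚ) ≤ r)]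
    refine ⟨L.flatMap fun b => cond b [(k : ℤ)] [(k : ℤ), k + 1], fun X Y => ?_,
      .inl ⟨?_, ?_, ?_, ?_⟩⟩
    · rw [fareyWord_mul_add, fareyWord_of_ge _ _ hp hr.le, fareyWord_of_ge _ _ (by omega) hle, h3]
      clear h1 h2 h3
      induction L with
      | nil => simp
      | cons b L ih => cases b <;> simp_all [mul_assoc, zpow_add]
    · have : ∀ K : List Bool, (K.flatMap fun b => cond b [(k : ℤ)] [(k : ℤ), k + 1]).length =
          K.count true + 2 * K.count false := by
        intro K
        induction K with
        | nil => simp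
        | cons b K ih => cases b <;> simp [ih] <;> omega
      rw [this, h1, h2]
      omega
    · have : ∀ K : List Bool, (K.flatMap fun b => cond b [(k : ℤ)] [(k : ℤ), k + 1]).sum =
          k * K.count true + (2 * k + 1) * K.count false := by
        intro K
        induction K with
        | nil => simp
        | cons b K ih => cases b <;> simp [ih] <;> ring
      rw [this, h1, h2]
      push_cast [hle, hr.le]
      ring
    · rw [hfloor]
      intro x hx
      obtain ⟨b, -, hb⟩ := List.mem_flatMap.1 hx
      cases b <;> simp_all
    · rw [hfloor, ← List.flatMap_append]
      exact not_infix_flatMap_left (by omega) _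
  · have hle' : p - r ≤ r := by omega
    obtain ⟨L, h1, h2, h3⟩ := exists_boolWord (p - r) (r - (p - r))
      ((Nat.coprime_sub_self_right hle').2 hc')
    -- Here 0 < r < p, so negation makes the isolated exponent -k the upper value.
    have hfloor : ⌊((-((k * p + r : ℕ) : ℤ) : ℤ) : ℚ) / p⌋ = -k - 1 := by
      rw [Int.floor_eq_iff, le_div_iff₀ hpQ, div_lt_iff₀ hpQ]
      have : (0 : ℚ) < r := by exact_mod_cast (show 0 < r by omega)
      push_cast
      constructor <;> nlinarith
    refine ⟨L.flatMap fun b => cond b [(k : ℤ), k + 1] [(k + 1 : ℤ)], fun X Y => ?_,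
      .inr ⟨?_, ?_, ?_, ?_⟩⟩
    · rw [fareyWord_mul_add, fareyWord_of_ge _ _ hp hr.le, fareyWord_of_le _ _ hle', h3]
      clear h1 h2 h3
      induction L with
      | nil => simp
      | cons b L ih => cases b <;> simp_all [mul_assoc, zpow_add]
    · have : ∀ K : List Bool, ((K.flatMap fun b => cond b [(k : ℤ), k + 1]
          [(k + 1 : ℤ)]).map Neg.neg).length = 2 * K.count true + K.count false := by
        intro K
        induction K with
        | nil => simp
        | cons b K ih => cases b <;> simp at ih ⊢ <;> omega
      rw [this, h1, h2]
      omega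
    · have : ∀ K : List Bool, ((K.flatMap fun b => cond b [(k : ℤ), k + 1]
          [(k + 1 : ℤ)]).map Neg.neg).sum =
            -((2 * k + 1) * K.count true + (k + 1) * K.count false) := by
        intro K
        induction K with
        | nil => simp
        | cons b K ih => cases b <;> simp at ih ⊢ <;> linarith
      rw [this, h1, h2]
      push_cast [hle', hr.le]
      ring
    · rw [hfloor]
      intro x hx
      obtain ⟨y, hy, rfl⟩ := List.mem_map.1 hx
      obtain ⟨b, -, hb⟩ := List.mem_flatMap.1 hy
      cases b <;> simp at hb <;> omega
    · have : (L.flatMap fun b => cond b [(k : ℤ), k + 1] [(k + 1 : ℤ)]).map Neg.neg =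
          L.flatMap fun b => cond b [-(k : ℤ) - 1 + 1, -k - 1] [-k - 1] := by
        rw [List.map_flatMap]
        congr 1
        funext b
        cases b <;> simp <;> ring
      rw [hfloor, this, ← List.flatMap_append]
      exact not_infix_flatMap_right (by omega) _

end ExponentLists

/-! ### The two normal forms -/

section NormalForm

theorem isConj_inv_inv {W V : F2} (h : IsConj W V) : IsConj W⁻¹ V⁻¹ := by
  obtain ⟨c, rfl⟩ := isConj_iff.1 h
  exact isConj_iff.2 ⟨c, by group⟩

namespace EqUpToConjInv

theorem of_eq_or_eq_inv {W V : F2} (h : W = V ∨ W = V⁻¹) : EqUpToConjInv W V := by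
  rcases h with rfl | rfl
  · exact .inl (IsConj.refl _)
  · exact .inr (by rw [inv_inv])

theorem symm {W V : F2} : EqUpToConjInv W V → EqUpToConjInv V W
  | .inl h => .inl h.symm
  | .inr h => .inr (by simpa using (isConj_inv_inv h).symm)

theorem trans {W V U : F2} : EqUpToConjInv W V → EqUpToConjInv V U → EqUpToConjInv W U
  | .inl h, .inl h' => .inl (h.trans h')
  | .inl h, .inr h' => .inr ((isConj_inv_inv h).trans h')
  | .inr h, .inl h' => .inr (h.trans h')
  | .inr h, .inr h' => .inl (by simpa using (isConj_inv_inv h).trans h')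

end EqUpToConjInv

theorem map_fareyWord (φ : F2 →* F2) (X Y : F2) (p q : ℕ) :
    φ (fareyWord X Y p q) = fareyWord (φ X) (φ Y) p q := by
  rw [fareyWord, fareyWord.eq_def (φ X)]
  split_ifs
  · rfl
  · rfl
  · rw [map_fareyWord, map_mul]
  · rw [map_fareyWord, map_mul]
termination_by p + q

theorem isConj_fareyWord_conj (g X Y : F2) (p q : ℕ) :
    IsConj (fareyWord X Y p q) (fareyWord (g * X * g⁻¹) (g * Y * g⁻¹) p q) :=
  isConj_iff.2 ⟨g, map_fareyWord (MulAut.conj g).toMonoidHom X Y p q⟩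

/-- Reflecting the Farey tree reverses each product; XY and YX differ by a conjugation that fixes
the other base word, so the discrepancy is simultaneous at every step. -/
theorem isConj_fareyWord_swap (X Y : F2) {p q : ℕ} (h : p.Coprime q) :
    IsConj (fareyWord X Y p q) (fareyWord Y X q p) := by
  rcases Nat.eq_zero_or_pos p with rfl | hp
  · obtain rfl : q = 1 := by simpa using h
    rw [fareyWord_zero_one, fareyWord_one_zero]
  rcases Nat.eq_zero_or_pos q with rfl | hq
  · obtain rfl : p = 1 := by simpa using h
    rw [fareyWord_zero_one, fareyWord_one_zero]
  by_cases hpq : p ≤ q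
  · rw [fareyWord_of_le X Y hpq, fareyWord_of_ge Y X hq hpq]
    refine (isConj_fareyWord_swap X (Y * X) ((Nat.coprime_sub_self_right hpq).2 h)).trans ?_
    simpa [mul_assoc] using isConj_fareyWord_conj X (Y * X) X (q - p) p
  · have hqp : q ≤ p := by omega
    rw [fareyWord_of_ge X Y hp hqp, fareyWord_of_le Y X hqp]
    refine (isConj_fareyWord_swap (Y * X) Y ((Nat.coprime_sub_self_left hqp).2 h)).trans ?_
    simpa [mul_assoc] using (isConj_fareyWord_conj Y Y (X * Y) q (p - q)).symm
termination_by p + q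

/-- Inversion reverses the syllables and leaves Y⁻¹ behind each power of X; one cyclic shift moves
it in front. -/
theorem inv_mul_inv_prod_map (Y X : F2) : ∀ E : List ℤ,
    Y⁻¹ * (E.map fun m => Y * X ^ m).prod⁻¹ =
      ((E.map Neg.neg).reverse.map fun m => Y⁻¹ * X ^ m).prod * Y⁻¹
  | [] => by simp
  | m :: E => by
    have ih := inv_mul_inv_prod_map Y X E
    simp only [List.map_cons, List.prod_cons, List.reverse_cons, List.map_append, List.map_nil,
      List.prod_append, List.prod_nil, mul_one, mul_inv_rev, zpow_neg] at ih ⊢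
    rw [← mul_assoc, ih]
    simp only [mul_assoc]

theorem eqUpToConjInv_prod_reverse (Y X : F2) (E : List ℤ) :
    EqUpToConjInv (E.map fun m => Y * X ^ m).prod
      ((E.map Neg.neg).reverse.map fun m => Y⁻¹ * X ^ m).prod :=
  .inr (isConj_iff.2 ⟨Y⁻¹, by rw [inv_mul_inv_prod_map, inv_inv, inv_mul_cancel_right]⟩)

/-- The sign δ records whether q or -q has balanced exponents. If it disagrees with σ, the word is
inverted, which reverses the list and makes the exponent of T equal to -1. -/
theorem exists_balancedExponents_of_sign (Z T : F2) {σ : ℤ} (hσ : σ = 1 ∨ σ = -1) {p q : ℕ}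
    (hp : 0 < p) (h : p.Coprime q) :
    ∃ δ : ℤ, (δ = 1 ∨ δ = -1) ∧ ∃ E : List ℤ, BalancedExponents p (δ * q) E ∧
      EqUpToConjInv (fareyWord (Z ^ σ) T p q) (E.map fun m => T ^ (σ * δ) * Z ^ m).prod := by
  obtain ⟨E, hE, hE' | hE'⟩ := exists_balancedExponents hp h
  · refine ⟨1, .inl rfl, ?_⟩
    rw [one_mul]
    rcases hσ with rfl | rfl
    · exact ⟨E, hE', .of_eq_or_eq_inv (.inl (by simp [hE]))⟩
    · refine ⟨E.reverse, hE'.reverse, ?_⟩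
      rw [hE]
      simpa [Function.comp_def] using eqUpToConjInv_prod_reverse T Z⁻¹ E
  · refine ⟨-1, .inr rfl, ?_⟩
    rw [neg_one_mul]
    rcases hσ with rfl | rfl
    · refine ⟨_, hE'.reverse, ?_⟩
      rw [hE]
      simpa [Function.comp_def] using eqUpToConjInv_prod_reverse T Z E
    · exact ⟨_, hE', .of_eq_or_eq_inv (.inl (by simp [hE, Function.comp_def]))⟩

theorem BalancedExponents.exists_formWord {k : ℕ} {m : ℤ} {E : List ℤ}
    (h : BalancedExponents k m E) {W X Y : F2} {ε : ℤ}
    (hW : EqUpToConjInv W (E.map fun m => X ^ ε * Y ^ m).prod) :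
    ∃ n : ℕ → ℤ, ExponentCondition k m n ∧ EqUpToConjInv W (formWord X Y ε k n) := by
  refine ⟨_, h.exponentCondition, ?_⟩
  rw [← h.length_eq, formWord_getD]
  exact hW

theorem eqUpToConjInv_primitiveWord {σ : ℤ} (hσ : σ = 1 ∨ σ = -1) {p q : ℤ} {a b : ℕ}
    (hpq : IsCoprime p q) (ha : p.natAbs = a) (hb : q.natAbs = b) (h : p * q = σ * (a * b)) :
    EqUpToConjInv (fareyWord (B ^ σ) A a b) (primitiveWord p q) := by
  have hab : (0 : ℤ) ≤ a * b := by positivity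
  subst ha hb
  refine (EqUpToConjInv.of_eq_or_eq_inv (primitiveWord_eq hpq ?_ ?_ ?_)).symm
  · rcases hσ with rfl | rfl <;> simp
  · rw [h]
    rcases hσ with rfl | rfl
    · simp
    · intro h0; omega
  · rw [h]
    rcases hσ with rfl | rfl
    · intro h0; omega
    · simp

/-- Every primitive element has one of the two normal forms, up to conjugation and inversion. -/
theorem IsPrimitive.exists_normalForm {W : F2} (hW : IsPrimitive W) :
      ∃ (ε p q : ℤ), (ε = 1 ∨ ε = -1) ∧ IsCoprime p q ∧
        EqUpToConjInv W (primitiveWord (ε * p) q) ∧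
        ((0 < p ∧ (p ≤ |q| ∨ q = 0) ∧
            ∃ n : ℕ → ℤ, ExponentCondition p.toNat q n ∧
              EqUpToConjInv W
                (formWord A B ε p.toNat n)) ∨
          (0 < q ∧ (q ≤ |p| ∨ p = 0) ∧
            ∃ n : ℕ → ℤ, ExponentCondition q.toNat p n ∧
              EqUpToConjInv W
                (formWord B A ε q.toNat n))) := by
  obtain ⟨X, hX, p, q, hc, hWX⟩ := hW.exists_fareyWord
  obtain ⟨σ, hσ, rfl⟩ : ∃ σ : ℤ, (σ = 1 ∨ σ = -1) ∧ X = B ^ σ := by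
    rcases hX with rfl | rfl
    · exact ⟨1, .inl rfl, by simp⟩
    · exact ⟨-1, .inr rfl, by simp⟩
  have hcZ : IsCoprime (p : ℤ) q := Nat.isCoprime_iff_coprime.2 hc
  by_cases hcase : 0 < p ∧ (p ≤ q ∨ q = 0)
  · obtain ⟨hp, hpq⟩ := hcase
    obtain ⟨δ, hδ, E, hE, hE'⟩ := exists_balancedExponents_of_sign B A hσ hp hc
    -- With ε = σδ the fraction ε p / (δ q) has the sign σ, since δ² = 1.
    refine ⟨σ * δ, p, δ * q, ?_, ?_, hWX.trans ?_, .inl ⟨by exact_mod_cast hp, ?_, ?_⟩⟩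
    · rcases hσ with rfl | rfl <;> rcases hδ with rfl | rfl <;> simp
    · rcases hδ with rfl | rfl <;> simpa [IsCoprime.neg_left_iff, IsCoprime.neg_right_iff] using hc
    · apply eqUpToConjInv_primitiveWord hσ
      · rcases hσ with rfl | rfl <;> rcases hδ with rfl | rfl <;> simpa [IsCoprime.neg_left_iff, IsCoprime.neg_right_iff] using hc
      · rcases hσ with rfl | rfl <;> rcases hδ with rfl | rfl <;> simp
      · rcases hδ with rfl | rfl <;> simp
      · rcases hδ with rfl | rfl <;> ring
    · rcases hδ with rfl | rfl <;> simpa using hpq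
    · exact hE.exists_formWord (hWX.trans hE')
  · have hq : 0 < q := by
      by_contra h0
      obtain rfl : q = 0 := by omega
      obtain rfl : p = 1 := by simpa using hc
      simp at hcase
    have hqp : q ≤ p ∨ p = 0 := by omega
    -- After the exchange of generators A carries the exponents, so σ is absorbed into T = B^σ and
    -- the sign parameter is 1.
    obtain ⟨δ, hδ, E, hE, hE'⟩ :=
      exists_balancedExponents_of_sign A (B ^ σ) (σ := 1) (.inl rfl) hq hc.symm
    simp only [zpow_one, one_mul, ← zpow_mul] at hE'
    refine ⟨σ * δ, δ * p, q, ?_, ?_, hWX.trans ?_, .inr ⟨by exact_mod_cast hq, ?_, ?_⟩⟩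
    · rcases hσ with rfl | rfl <;> rcases hδ with rfl | rfl <;> simp
    · rcases hδ with rfl | rfl <;> simpa [IsCoprime.neg_left_iff, IsCoprime.neg_right_iff] using hc
    · apply eqUpToConjInv_primitiveWord hσ
      · rcases hσ with rfl | rfl <;> rcases hδ with rfl | rfl <;> simpa [IsCoprime.neg_left_iff, IsCoprime.neg_right_iff] using hc
      · rcases hσ with rfl | rfl <;> rcases hδ with rfl | rfl <;> simp
      · simp
      · rcases hδ with rfl | rfl <;> ring
    · rcases hδ with rfl | rfl <;> simpa using hqp
    · exact hE.exists_formWord (hWX.trans (.trans (.inl (isConj_fareyWord_swap _ _ hc)) hE'))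

end NormalForm

end PrimitiveWords

theorem mainTheorem1 :
    -- every primitive element has one of the two forms, up to conjugation and inversion
    (∀ W : PrimitiveWords.F2, PrimitiveWords.IsPrimitive W →
      ∃ (ε p q : ℤ), (ε = 1 ∨ ε = -1) ∧ IsCoprime p q ∧
        PrimitiveWords.EqUpToConjInv W (PrimitiveWords.primitiveWord (ε * p) q) ∧
        ((0 < p ∧ (p ≤ |q| ∨ q = 0) ∧
            ∃ n : ℕ → ℤ, PrimitiveWords.ExponentCondition p.toNat q n ∧
              PrimitiveWords.EqUpToConjInv W
                (PrimitiveWords.formWord PrimitiveWords.A PrimitiveWords.B ε p.toNat n)) ∨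
          (0 < q ∧ (q ≤ |p| ∨ p = 0) ∧
            ∃ n : ℕ → ℤ, PrimitiveWords.ExponentCondition q.toNat p n ∧
              PrimitiveWords.EqUpToConjInv W
                (PrimitiveWords.formWord PrimitiveWords.B PrimitiveWords.A ε q.toNat n)))) ∧
    -- the words attached to `p/q` and `r/s` are associates exactly for Farey neighbours
    (∀ p q r s : ℤ, IsCoprime p q → IsCoprime r s →
      (PrimitiveWords.PrimitiveAssociates
          (PrimitiveWords.primitiveWord p q) (PrimitiveWords.primitiveWord r s) ↔
        |p * s - q * r| = 1)) := by
  exact ⟨fun _ hW => hW.exists_normalForm,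
    fun _ _ _ _ hpq hrs => PrimitiveWords.primitiveAssociates_primitiveWord_iff hpq hrs⟩
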